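/- Proposition. For every integer $m \ge 0$ there is an integer $n_m \ge 1$ such that the following holds for every alphabet $A$ with exactly $m$ letters and every finite nondeterministic automaton $\mathcal{A}$ over $A$ (with a finite set $Q$ of states, a transition relation $\delta \subseteq Q \times A \times Q$, a set $I \subseteq Q$ of initial states and a set $F \subseteq Q$ of final states) whose number of states $n = |Q|$ satisfies $n \ge n_m$. (1) Let $L_{\mathrm{NFA}}(\mathcal{A}) \subseteq A^*$ be the set of finite words labelling a run from an initial state to a final state. There are a finite semigroup $S$ with fewer than $2^{n^2}$ elements and a surjective semigroup morphism $h \colon A^+ \to S$ that recognizes $L_{\mathrm{NFA}}(\mathcal{A}) \cap A^+$, i.e. this language is a union of sets $[s] = h^{-1}(s)$ with $s \in S$. (2) Let $L_{\mathrm{NBA}}(\mathcal{A}) \subseteq A^\omega$ be the set of infinite words labelling an infinite run that starts in an initial state and visits some final state infinitely often. There are a finite semigroup $S$ with fewer than $2^{n^2}$ elements and a surjective semigroup morphism $h \colon A^+ \to S$ that weakly recognizes $L_{\mathrm{NBA}}(\mathcal{A})$, i.e. this language is a union of sets $[s][e]^\omega$ where each $(s,e) \in S \times S$ is a linked pair,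 meaning $se = s$ and $e^2 = e$. Here $[s][e]^\omega$ is the set of all infinite words $u v_1 v_2 v_3 \cdots$ with $u \in [s]$ and $v_i \in [e]$ for all $i \ge 1$. Here $A^+$ is the free semigroup of nonempty finite words over $A$. In the degenerate case $m = 0$ it is empty, and then $S$ is the empty semigroup. -/

import Mathlib

open Filter

universe u v

namespace BuchiRecognition

/-- The list of letters of a nonempty finite word, i.e. of an element of `A⁺`. -/
def letters {A : Type u} (w : FreeSemigroup A) : List A :=
  w.head :: w.tail

/-- The part in `A⁺` of the language of finite words accepted by an automaton. -/
def finiteLanguage {A : Type u} {Q : Type v} (M : NFA A Q) : Set (FreeSemigroup A) :=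
  {w | letters w ∈ M.accepts}

/-- `r` is an infinite run of the automaton `M` with label `α`. -/
def IsInfiniteRun {A : Type u} {Q : Type v} (M : NFA A Q) (α : Stream' A) (r : ℕ → Q) : Prop :=
  r 0 ∈ M.start ∧ ∀ i, r (i + 1) ∈ M.step (r i) (α.get i)

/-- The set of states which occur infinitely often in a sequence of states. -/
def infOcc {Q : Type v} (r : ℕ → Q) : Set Q :=
  {q | ∃ᶠ i in atTop, r i = q}

/-- The language of infinite words Büchi-accepted by an automaton. -/
def buchiLanguage {A : Type u} {Q : Type v} (M : NFA A Q) : Set (Stream' A) :=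
  {α | ∃ r : ℕ → Q, IsInfiniteRun M α r ∧ (infOcc r ∩ M.accept).Nonempty}

/-- The product `K L` of a set of nonempty finite words with a set of infinite words. -/
def concat {A : Type u} (K : Set (FreeSemigroup A)) (L : Set (Stream' A)) : Set (Stream' A) :=
  {α | ∃ w ∈ K, ∃ β ∈ L, α = letters w ++ₛ β}

/-- `α` is the infinite product `w 0 · w 1 · w 2 ⋯`: each finite product `w 0 ⋯ w (n - 1)` is a
prefix of `α`. As all factors are nonempty, this determines `α`. -/
def IsInfiniteProduct {A : Type u} (w : ℕ → FreeSemigroup A) (α : Stream' A) : Prop :=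
  ∀ n : ℕ, ∃ β : Stream' A, α = (List.range n).flatMap (fun i => letters (w i)) ++ₛ β

/-- The infinite iteration `K^ω` of a set of nonempty finite words. -/
def omegaPower {A : Type u} (K : Set (FreeSemigroup A)) : Set (Stream' A) :=
  {α | ∃ w : ℕ → FreeSemigroup A, (∀ i, w i ∈ K) ∧ IsInfiniteProduct w α}

/-- The preimage `[s] = h⁻¹(s)`. -/
def fiber {A : Type u} {S : Type v} [Semigroup S] (h : FreeSemigroup A →ₙ* S) (s : S) :
    Set (FreeSemigroup A) :=
  {w | h w = s}

/-- `(s, e)` is a linked pair. -/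
def IsLinkedPair {S : Type v} [Semigroup S] (p : S × S) : Prop :=
  p.1 * p.2 = p.1 ∧ p.2 * p.2 = p.2

/-- `L ⊆ A⁺` is recognized by `h`: it is a union of sets `[s]`. -/
def Recognizes {A : Type u} {S : Type v} [Semigroup S] (h : FreeSemigroup A →ₙ* S)
    (L : Set (FreeSemigroup A)) : Prop :=
  ∃ T : Set S, L = ⋃ s ∈ T, fiber h s

/-- `L ⊆ A^ω` is weakly recognized by `h`: it is a union of sets `[s][e]^ω` where the `(s, e)` are
linked pairs. -/
def WeaklyRecognizes {A : Type u} {S : Type v} [Semigroup S] (h : FreeSemigroup A →ₙ* S)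
    (L : Set (Stream' A)) : Prop :=
  ∃ P : Set (S × S), (∀ p ∈ P, IsLinkedPair p) ∧
    L = ⋃ p ∈ P, concat (fiber h p.1) (omegaPower (fiber h p.2))

end BuchiRecognition

/-! The semigroup is the image of the transition morphism, which sends a word to the relation it
induces on the states. There are `2 ^ (n ^ 2)` relations on `n` points, so it suffices that `m`
letters cannot generate all of them once `n ≥ 2 * m + 3`.

Call a relation prime if every factorization of it has a permutation as a factor. Writing a prime as
a product of generators and peeling these off shows that some generator equals it up to permuting
rows and columns, hence has equally many pairs (`IsPrime.exists_letter`). The relations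
`chordedCycle n k` for `k = 0, …, m` are prime and have distinct numbers of pairs, so they require
`m + 1` different letters.

Transitions determine acceptance of finite words. For Büchi acceptance, Ramsey's theorem is applied
only to positions at which an accepting run is in one fixed final state `q`. Every word in the
idempotent class obtained then leads from `q` to `q`, so the relations need not record visits to
final states. -/

namespace BuchiRecognition

/-! ### Relations and prime factorization -/

/-- Binary relations on a type, with composition as multiplication. -/
def BoolRel (α : Type v) : Type v := α → α → Prop

namespace BoolRel

variable {α : Type v}

@[ext] theorem ext {R R' : BoolRel α} (h : ∀ i j, R i j ↔ R' i j) : R = R' :=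
  funext fun i => funext fun j => propext (h i j)

instance : Semigroup (BoolRel α) where
  mul R R' := fun i j => ∃ k, R i k ∧ R' k j
  mul_assoc R R' R'' := by
    ext i j
    constructor
    · rintro ⟨k, ⟨l, h₁, h₂⟩, h₃⟩
      exact ⟨l, h₁, k, h₂, h₃⟩
    · rintro ⟨l, h₁, k, h₂, h₃⟩
      exact ⟨k, ⟨l, h₁, h₂⟩, h₃⟩

theorem mul_apply {R R' : BoolRel α} {i j : α} : (R * R') i j ↔ ∃ k, R i k ∧ R' k j := Iff.rfl

instance [Finite α] : Finite (BoolRel α) := inferInstanceAs (Finite (α → α → Prop))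

theorem card_eq (α : Type v) [Fintype α] : Nat.card (BoolRel α) = 2 ^ (Fintype.card α ^ 2) := by
  classical
  change Nat.card (α → α → Prop) = _
  simp [Nat.card_eq_fintype_card, ← pow_mul, sq]

/-- The graph of a permutation. -/
def ofPerm (π : Equiv.Perm α) : BoolRel α := fun i j => π i = j

/-- In every factorization of the relation, one of the factors is a permutation. -/
def IsPrime (R : BoolRel α) : Prop :=
  ∀ B C : BoolRel α, R = B * C → (∃ π, B = ofPerm π) ∨ ∃ π, C = ofPerm π

/-- The set of pairs which belong to a relation. -/
def graph (R : BoolRel α) : Set (α × α) := {p | R p.1 p.2}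

/-- The number of pairs is the invariant that forces different primes to come from different
letters. -/
theorem ncard_graph_perm_mul_perm (π σ : Equiv.Perm α) (R : BoolRel α) :
    (ofPerm π * R * ofPerm σ).graph.ncard = R.graph.ncard := by
  have h : (ofPerm π * R * ofPerm σ).graph = (Equiv.prodCongr π.symm σ) '' R.graph := by
    ext ⟨i, j⟩
    constructor
    · rintro ⟨k, ⟨l, hl, h⟩, hk⟩
      refine ⟨(l, k), h, ?_⟩
      have hl : π i = l := hl
      have hk : σ k = j := hk
      simp [← hl, hk]
    · rintro ⟨⟨l, k⟩, h, e⟩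
      obtain ⟨e₁, e₂⟩ := Prod.mk.inj e
      exact ⟨k, ⟨l, show π i = l by simp [← e₁], h⟩, e₂⟩
  rw [h, Set.ncard_image_of_injective _ (Equiv.injective _)]

theorem ofPerm_mul_ofPerm (π σ : Equiv.Perm α) :
    ofPerm π * ofPerm σ = ofPerm (σ * π) := by
  ext i j
  constructor
  · rintro ⟨k, hk, hj⟩
    have hk : π i = k := hk
    have hj : σ k = j := hj
    change σ (π i) = j
    rw [hk, hj]
  · intro h
    exact ⟨π i, rfl, h⟩

theorem ofPerm_one_mul (R : BoolRel α) : ofPerm 1 * R = R := by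
  ext i j
  constructor
  · rintro ⟨k, hk, hj⟩
    have hk : i = k := hk
    rwa [hk]
  · intro h
    exact ⟨i, rfl, h⟩

theorem mul_ofPerm_one (R : BoolRel α) : R * ofPerm 1 = R := by
  ext i j
  constructor
  · rintro ⟨k, hk, hj⟩
    have hj : k = j := hj
    rwa [← hj]
  · intro h
    exact ⟨j, h, rfl⟩

/-- A prime relation which is a product of generators agrees with a generator, up to
permutations of the rows and of the columns. -/
theorem IsPrime.exists_letter {A : Type u} (h : FreeSemigroup A →ₙ* BoolRel α) {R : BoolRel α}
    (hR : R.IsPrime) (w : FreeSemigroup A) (π σ : Equiv.Perm α)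
    (hw : R = ofPerm π * h w * ofPerm σ) :
    ∃ (a : A) (π σ : Equiv.Perm α), R = ofPerm π * h (FreeSemigroup.of a) * ofPerm σ := by
  induction w using FreeSemigroup.recOnMul generalizing π σ with
  | ih1 a => exact ⟨a, π, σ, hw⟩
  | ih2 a y iha ihy =>
    have e : R = (ofPerm π * h (FreeSemigroup.of a)) * (h y * ofPerm σ) := by
      rw [hw, map_mul]
      simp only [mul_assoc]
    rcases hR _ _ e with ⟨τ, hτ⟩ | ⟨τ, hτ⟩
    · exact ihy τ σ (by rw [e, hτ, mul_assoc])
    · exact iha π τ (by rw [e, hτ])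

/-- A section of the partial map `k ↦ i` is injective, hence bijective by finiteness; its inverse is
the permutation. -/
theorem exists_perm_of_functional [Finite α] (r : α → α → Prop)
    (hr : ∀ k i i', r k i → r k i' → i = i') (ht : ∀ i, ∃ k, r k i) :
    ∃ π : Equiv.Perm α, ∀ k i, r k i ↔ π k = i := by
  choose f hf using ht
  have hinj : Function.Injective f := fun i i' h => hr _ _ _ (hf i) (h ▸ hf i')
  have hbij := Finite.injective_iff_bijective.mp hinj
  refine ⟨(Equiv.ofBijective f hbij).symm, fun k i => ?_⟩
  rw [Equiv.symm_apply_eq, Equiv.ofBijective_apply]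
  constructor
  · intro h
    obtain ⟨i', rfl⟩ := hbij.2 k
    rw [hr _ _ _ h (hf i')]
  · rintro rfl
    exact hf i

/-- A relation without 2 × 2 rectangles which satisfies a strict form of Hall's condition is
prime. -/
theorem isPrime_of_hall [Fintype α] {R : BoolRel α}
    (hC4 : ∀ i i' j j', R i j → R i j' → R i' j → R i' j' → i = i' ∨ j = j')
    (hHall : ∀ X D : Finset α, (∀ i ∈ X, ∀ j, R i j → j ∈ D) → D.card ≤ X.card →
      X = ∅ ∨ D = Finset.univ) : R.IsPrime := by
  classical
  intro B C hBC
  have hR : ∀ {i j}, R i j ↔ ∃ k, B i k ∧ C k j := fun {i j} => by rw [hBC, mul_apply]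
  -- Each middle point `k` contributes the rectangle `{i | B i k} × {j | C k j}` to `R`, so one of
  -- its sides has at most one element. `K` collects the points whose row side is that small.
  let K : Finset α := {k | ∀ i i', B i k → B i' k → i = i'}
  have hK : ∀ k ∈ K, ∀ i i', B i k → B i' k → i = i' := fun k hk => (Finset.mem_filter.mp hk).2
  have hK' : ∀ k ∈ Kᶜ, ∀ j j', C k j → C k j' → j = j' := by
    intro k hk j j' hj hj'
    have hk : ¬ ∀ i i', B i k → B i' k → i = i' := fun h =>
      Finset.mem_compl.mp hk (Finset.mem_filter.mpr ⟨Finset.mem_univ _, h⟩)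
    push Not at hk
    obtain ⟨i, i', hi, hi', hne⟩ := hk
    exact (hC4 i i' j j' (hR.mpr ⟨k, hi, hj⟩) (hR.mpr ⟨k, hi, hj'⟩) (hR.mpr ⟨k, hi', hj⟩)
      (hR.mpr ⟨k, hi', hj'⟩)).resolve_left hne
  -- `Y` consists of the rows served by `K`, `D` of the columns served by its complement. Rows
  -- outside `Y` have all their neighbours in `D`, and `D.card ≤ Kᶜ.card ≤ Yᶜ.card`, so the Hall
  -- condition applies to `Yᶜ` and `D`.
  let Y : Finset α := {i | ∃ k ∈ K, B i k}
  let D : Finset α := {j | ∃ k ∈ Kᶜ, C k j}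
  have hY : ∀ i ∈ Y, ∃ k ∈ K, B i k := fun i hi => (Finset.mem_filter.mp hi).2
  have hD : ∀ j ∈ D, ∃ k ∈ Kᶜ, C k j := fun i hi => (Finset.mem_filter.mp hi).2
  have hYK : Y.card ≤ K.card := by
    choose! f hf using hY
    refine Finset.card_le_card_of_injOn f (fun i hi => (hf i hi).1) fun i hi i' hi' e => ?_
    exact hK _ (hf i hi).1 _ _ (hf i hi).2 (e ▸ (hf i' hi').2)
  have hDK : D.card ≤ Kᶜ.card := by
    choose! f hf using hD
    refine Finset.card_le_card_of_injOn f (fun i hi => (hf i hi).1) fun i hi i' hi' e => ?_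
    exact hK' _ (hf i hi).1 _ _ (hf i hi).2 (e ▸ (hf i' hi').2)
  have hYD : ∀ i ∈ Yᶜ, ∀ j, R i j → j ∈ D := by
    intro i hi j hij
    obtain ⟨k, hk, hk'⟩ := hR.mp hij
    refine Finset.mem_filter.mpr ⟨Finset.mem_univ _, k, Finset.mem_compl.mpr fun hkK => ?_, hk'⟩
    exact Finset.mem_compl.mp hi (Finset.mem_filter.mpr ⟨Finset.mem_univ _, k, hkK, hk⟩)
  have hc₁ := Finset.card_compl_add_card Y
  have hc₂ := Finset.card_compl_add_card K
  rcases hHall Yᶜ D hYD (by omega) with h | h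
  · left
    rw [h, Finset.card_empty] at hc₁
    have hKu : K = Finset.univ := (Finset.card_eq_iff_eq_univ K).mp (by omega)
    rw [Finset.compl_eq_empty_iff] at h
    obtain ⟨π, hπ⟩ := exists_perm_of_functional (fun k i => B i k)
      (fun k => hK k (by simp [hKu])) fun i => (hY i (by simp [h])).imp fun _ => And.right
    refine ⟨π.symm, ext fun i k => ?_⟩
    rw [hπ, ofPerm, Equiv.symm_apply_eq, eq_comm]
  · right
    have hDu := Finset.card_univ (α := α)
    rw [← h] at hDu
    have hKu : Kᶜ = Finset.univ := (Finset.card_eq_iff_eq_univ _).mp (by omega)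
    obtain ⟨π, hπ⟩ := exists_perm_of_functional (fun k j => C k j)
      (fun k => hK' k (by simp [hKu])) fun j => (hD j (by simp [h])).imp fun _ => And.right
    exact ⟨π, ext hπ⟩

/-! ### Primes with different numbers of pairs -/

/-- A directed cycle with loops, and with `k` further pairs in its first row. -/
def chordedCycle (n k : ℕ) : BoolRel (Fin n) := fun i j =>
  j = i ∨ (j : ℕ) = (i + 1) % n ∨ ((i : ℕ) = 0 ∧ (j : ℕ) % 2 = 1 ∧ (j : ℕ) ≤ 2 * k + 1)

theorem chordedCycle_cases {n k : ℕ} {i j : Fin n} (h : chordedCycle n k i j) :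
    (j : ℕ) = i ∨ (j : ℕ) = i + 1 ∨ ((i : ℕ) + 1 = n ∧ (j : ℕ) = 0) ∨
      ((i : ℕ) = 0 ∧ (j : ℕ) % 2 = 1 ∧ (j : ℕ) ≤ 2 * k + 1) := by
  rcases h with h | h | h
  · exact Or.inl (by rw [h])
  · rcases Nat.lt_or_ge ((i : ℕ) + 1) n with h' | h'
    · rw [Nat.mod_eq_of_lt h'] at h
      exact Or.inr (Or.inl h)
    · have e : (i : ℕ) + 1 = n := le_antisymm i.2 h'
      rw [e, Nat.mod_self] at h
      exact Or.inr (Or.inr (Or.inl ⟨e, h⟩))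
  · exact Or.inr (Or.inr (Or.inr h))

theorem eq_univ_of_closed {n : ℕ} {X : Finset (Fin n)} (hX : X.Nonempty)
    (h : ∀ i ∈ X, ∀ j : Fin n, (j : ℕ) = (i + 1) % n → j ∈ X) : X = Finset.univ := by
  obtain ⟨i, hi⟩ := hX
  have hn : 0 < n := i.pos
  have key : ∀ t : ℕ, (⟨(i + t) % n, Nat.mod_lt _ hn⟩ : Fin n) ∈ X := by
    intro t
    induction t with
    | zero => simpa [Nat.mod_eq_of_lt i.2] using hi
    | succ t ih => exact h _ ih _ (by simp [← add_assoc])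
  refine Finset.eq_univ_iff_forall.mpr fun j => ?_
  -- From `i`, the cycle reaches `0` after `n - i` steps and `j` after `j` more.
  convert! key (n - i + j) using 1
  ext
  have hij : (i : ℕ) + (n - i + j) = n + j := by omega
  simp [hij, Nat.mod_eq_of_lt j.2]

theorem isPrime_chordedCycle {n k : ℕ} (hn : 2 * k + 3 ≤ n) : (chordedCycle n k).IsPrime := by
  refine isPrime_of_hall ?_ ?_
  -- A row other than row 0 consists of two cyclically adjacent columns, and two such rows share at
  -- most one column. Row 0 contains `0` and odd columns up to `2 * k + 1`, so its only possible
  -- adjacent pairs are `{0, 1}`, which is no other row, and `{n - 1, 0}`, excluded by `n - 1 > 2 *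
  -- k + 1`.
  · intro i i' j j' h₁ h₂ h₃ h₄
    simp only [Fin.ext_iff]
    have hi := i.2
    have hi' := i'.2
    have h₁ := chordedCycle_cases h₁
    have h₂ := chordedCycle_cases h₂
    have h₃ := chordedCycle_cases h₃
    have h₄ := chordedCycle_cases h₄
    omega
  · intro X D hXD hcard
    refine X.eq_empty_or_nonempty.imp_right fun hX => ?_
    -- The loops give `X ⊆ D`, so the cardinalities force equality, and `X` is closed under the
    -- cycle.
    have e : X = D := Finset.eq_of_subset_of_card_le (fun i hi => hXD i hi i (Or.inl rfl)) hcard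
    subst e
    exact eq_univ_of_closed hX fun i hi j hj => hXD i hi j (Or.inr (Or.inl hj))

theorem ncard_graph_chordedCycle_lt {n k l : ℕ} (hkl : k < l) (hl : 2 * l + 3 ≤ n) :
    (chordedCycle n k).graph.ncard < (chordedCycle n l).graph.ncard := by
  refine Set.ncard_lt_ncard ⟨?_, fun h => ?_⟩ (Set.toFinite _)
  · rintro ⟨i, j⟩ (h | h | ⟨h₁, h₂, h₃⟩)
    · exact Or.inl h
    · exact Or.inr (Or.inl h)
    · exact Or.inr (Or.inr ⟨h₁, h₂, h₃.trans (by omega)⟩)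
  -- The last chord of the larger relation is missing from the smaller one.
  · have hmem : ((⟨0, by omega⟩, ⟨2 * l + 1, by omega⟩) : Fin n × Fin n) ∈
        (chordedCycle n l).graph := Or.inr (Or.inr ⟨rfl, by simp, le_rfl⟩)
    have h := chordedCycle_cases (h hmem)
    simp only at h
    omega

/-- Large semigroups of relations need many generators. -/
theorem not_surjective_of_card_lt {A : Type u} [Fintype A] {n : ℕ}
    (hn : 2 * Fintype.card A + 3 ≤ n) (h : FreeSemigroup A →ₙ* BoolRel (Fin n)) :
    ¬ Function.Surjective h := by
  intro hs
  have key : ∀ k : Fin (Fintype.card A + 1),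
      ∃ a : A, (h (FreeSemigroup.of a)).graph.ncard = (chordedCycle n k).graph.ncard := by
    intro k
    obtain ⟨w, hw⟩ := hs (chordedCycle n k)
    obtain ⟨a, π, σ, ha⟩ := (isPrime_chordedCycle (n := n) (k := k) (by omega)).exists_letter h w
      1 1 (by rw [ofPerm_one_mul, mul_ofPerm_one, hw])
    exact ⟨a, by rw [ha, ncard_graph_perm_mul_perm]⟩
  choose f hf using key
  have hinj : Function.Injective f := by
    intro k l e
    have e' : (chordedCycle n k).graph.ncard = (chordedCycle n l).graph.ncard := by
      rw [← hf, ← hf, e]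
    by_contra hne
    rcases lt_or_gt_of_ne hne with hlt | hlt
    · exact (ncard_graph_chordedCycle_lt (n := n) hlt (by omega)).ne e'
    · exact (ncard_graph_chordedCycle_lt (n := n) hlt (by omega)).ne e'.symm
  have := Fintype.card_le_of_injective f hinj
  simp at this

end BoolRel

/-! ### Factors of infinite words -/

theorem letters_mul {A : Type u} (x y : FreeSemigroup A) :
    letters (x * y) = letters x ++ letters y := rfl

theorem letters_injective {A : Type u} : Function.Injective (letters (A := A)) := by
  rintro ⟨a, l⟩ ⟨b, l'⟩ h
  obtain ⟨rfl, rfl⟩ := List.cons.inj h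
  rfl

theorem length_letters_pos {A : Type u} (x : FreeSemigroup A) : 0 < (letters x).length :=
  Nat.succ_pos _

/-- The factor of an infinite word between two positions. -/
def segment {A : Type u} (α : Stream' A) (i j : ℕ) : List A := (List.Ico i j).map α.get

section Segment

variable {A : Type u} (α : Stream' A)

theorem segment_append {i j k : ℕ} (hij : i ≤ j) (hjk : j ≤ k) :
    segment α i j ++ segment α j k = segment α i k := by
  rw [segment, segment, segment, ← List.map_append, List.Ico.append_consecutive hij hjk]

theorem segment_self (i : ℕ) : segment α i i = [] := by
  simp [segment]

theorem segment_succ {i j : ℕ} (hij : i ≤ j) :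
    segment α i (j + 1) = segment α i j ++ [α.get j] := by
  simp [segment, List.Ico.succ_top hij]

theorem length_segment (i j : ℕ) : (segment α i j).length = j - i := by
  simp [segment]

theorem exists_letters_eq_segment {i j : ℕ} (hij : i < j) :
    ∃ w : FreeSemigroup A, letters w = segment α i j :=
  ⟨⟨α.get i, segment α (i + 1) j⟩, by simp [letters, segment, List.Ico.eq_cons hij]⟩

theorem segment_append_drop {i j : ℕ} (hij : i ≤ j) :
    segment α i j ++ₛ α.drop j = α.drop i := by
  induction j, hij using Nat.le_induction with
  | base => simp [segment_self]
  | succ j hij ih =>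
    rw [segment_succ α hij, Stream'.append_append_stream, ← ih]
    congr 1
    ext t
    cases t with
    | zero => simp [Stream'.get_drop]
    | succ t => simp [Stream'.get_drop, Stream'.get_succ, add_comm, add_left_comm]

variable {α}

theorem eq_segment_of_eq_append {l : List A} {β : Stream' A} (h : α = l ++ₛ β) :
    l = segment α 0 l.length := by
  refine Stream'.append_left_injective l (segment α 0 l.length) β (α.drop l.length) ?_
    (by simp [length_segment])
  rw [segment_append_drop α (Nat.zero_le _), ← h]
  rfl

/-- The cut points are the lengths of the partial products; they increase strictly because every
factor is nonempty. -/
theorem IsInfiniteProduct.exists_positions {w : ℕ → FreeSemigroup A}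
    (h : IsInfiniteProduct w α) :
    ∃ p : ℕ → ℕ, StrictMono p ∧ p 0 = 0 ∧ ∀ n, letters (w n) = segment α (p n) (p (n + 1)) := by
  let l : ℕ → List A := fun n => (List.range n).flatMap fun i => letters (w i)
  have hl : ∀ n, l (n + 1) = l n ++ letters (w n) := fun n => by simp [l, List.range_succ]
  have hlt : ∀ n, (l n).length < (l (n + 1)).length := fun n => by
    simp [hl, length_letters_pos]
  refine ⟨fun n => (l n).length, strictMono_nat_of_lt_succ hlt, rfl, fun n => ?_⟩
  have hseg : ∀ n, l n = segment α 0 (l n).length := fun n => by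
    obtain ⟨β, hβ⟩ := h n
    exact eq_segment_of_eq_append hβ
  have e := hseg (n + 1)
  rw [← segment_append α (Nat.zero_le _) (hlt n).le, ← hseg, hl] at e
  rw [List.append_cancel_left e, ← hl]

theorem isInfiniteProduct_of_positions {w : ℕ → FreeSemigroup A} {p : ℕ → ℕ} (hp : Monotone p)
    (hw : ∀ n, letters (w n) = segment α (p n) (p (n + 1))) :
    IsInfiniteProduct w (α.drop (p 0)) := by
  intro n
  refine ⟨α.drop (p n), ?_⟩
  have e : ((List.range n).flatMap fun i => letters (w i)) = segment α (p 0) (p n) := by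
    induction n with
    | zero => simp [segment_self]
    | succ n ih =>
      rw [List.range_succ, List.flatMap_append, ih, List.flatMap_singleton, hw,
        segment_append α (hp (Nat.zero_le n)) (hp n.le_succ)]
  rw [e, segment_append_drop α (hp (Nat.zero_le n))]

theorem IsInfiniteProduct.cons {w : ℕ → FreeSemigroup A} {β : Stream' A}
    (h : IsInfiniteProduct w β) (u : FreeSemigroup A) :
    IsInfiniteProduct (fun n => Nat.casesOn n u w) (letters u ++ₛ β) := by
  intro n
  cases n with
  | zero => exact ⟨letters u ++ₛ β, by simp⟩
  | succ n =>
    obtain ⟨γ, hγ⟩ := h n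
    refine ⟨γ, ?_⟩
    rw [hγ, List.range_succ_eq_map, List.flatMap_cons, List.flatMap_map,
      Stream'.append_append_stream]
    rfl

end Segment

/-! ### Ramsey's theorem -/

/-- The infinite Ramsey theorem for pairs. -/
theorem exists_monochromatic {S : Type v} [Finite S] (c : ℕ → ℕ → S) :
    ∃ (e : S) (f : ℕ → ℕ), StrictMono f ∧ ∀ i j, i < j → c (f i) (f j) = e := by
  -- Along a nonprincipal ultrafilter, each `i` has a dominant colour `d i`, and `d` has a dominant
  -- value `e`. Points with `d i = e` can then be picked greedily: finitely many constraints, each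
  -- holding almost everywhere, hold simultaneously.
  let U : Ultrafilter ℕ := hyperfilter ℕ
  have h₁ : ∀ i, ∃ s, ∀ᶠ j in U, c i j = s := fun i =>
    (Ultrafilter.eventually_exists_iff (f := U) (P := fun s j => c i j = s)).mp
      (Eventually.of_forall fun j => ⟨_, rfl⟩)
  choose d hd using h₁
  obtain ⟨e, he⟩ : ∃ e, ∀ᶠ i in U, d i = e :=
    (Ultrafilter.eventually_exists_iff (f := U) (P := fun s i => d i = s)).mp
      (Eventually.of_forall fun j => ⟨_, rfl⟩)
  have hgt : ∀ i : ℕ, ∀ᶠ j : ℕ in U, i < j := fun i => by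
    have : ∀ᶠ j in cofinite, i < j := by
      rw [Nat.cofinite_eq_atTop]
      exact eventually_gt_atTop i
    exact hyperfilter_le_cofinite this
  obtain ⟨f, -, hf⟩ := exists_seq_of_forall_finset_exists (fun i => d i = e)
    (fun i j => i < j ∧ c i j = e) fun s hs => by
      have : ∀ᶠ j in U, d j = e ∧ ∀ i ∈ s, i < j ∧ c i j = e := by
        refine he.and ((eventually_all_finset s).mpr fun i hi => ?_)
        have hdi := hd i
        rw [hs i hi] at hdi
        exact (hgt i).and hdi
      exact this.exists
  exact ⟨e, f, fun i j hij => (hf i j hij).1, fun i j hij => (hf i j hij).2⟩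

/-! ### Runs and their factors -/

section Runs

variable {A : Type u} {Q : Type v} (M : NFA A Q) (α : Stream' A)

theorem mem_evalFrom_segment {r : ℕ → Q} (hr : ∀ t, r (t + 1) ∈ M.step (r t) (α.get t))
    {i j : ℕ} (hij : i ≤ j) : r j ∈ M.evalFrom {r i} (segment α i j) := by
  induction j, hij using Nat.le_induction with
  | base => simp [segment_self]
  | succ j hij ih =>
    rw [segment_succ α hij, NFA.evalFrom_append, NFA.evalFrom_singleton, NFA.mem_stepSet]
    exact ⟨_, ih, hr j⟩

theorem exists_path_of_mem_evalFrom_segment {i j : ℕ} (hij : i ≤ j) {q q' : Q}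
    (h : q' ∈ M.evalFrom {q} (segment α i j)) :
    ∃ r : ℕ → Q, r i = q ∧ r j = q' ∧
      ∀ t, i ≤ t → t < j → r (t + 1) ∈ M.step (r t) (α.get t) := by
  induction j, hij using Nat.le_induction generalizing q' with
  | base =>
    rw [segment_self] at h
    exact ⟨fun _ => q, rfl, h.symm, fun t h₁ h₂ => by omega⟩
  | succ j hij ih =>
    rw [segment_succ α hij, NFA.evalFrom_append, NFA.evalFrom_singleton, NFA.mem_stepSet] at h
    obtain ⟨q'', h', hs⟩ := h
    obtain ⟨r, hi, hj, hr⟩ := ih h'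
    refine ⟨Function.update r (j + 1) q', ?_, by simp, fun t h₁ h₂ => ?_⟩
    · rw [Function.update_of_ne (by omega), hi]
    · rw [Function.update_of_ne (a := t) (by omega)]
      rcases Nat.lt_succ_iff_lt_or_eq.mp h₂ with h | rfl
      · rw [Function.update_of_ne (by omega)]
        exact hr t h₁ h
      · rw [Function.update_self, hj]
        exact hs

/-- Paths over consecutive blocks can be glued, since at each cut point both neighbouring paths are
in the state prescribed by `s`. -/
theorem exists_run_of_segments {p : ℕ → ℕ} (hp : StrictMono p) (hp₀ : p 0 = 0) {s : ℕ → Q}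
    (h : ∀ k, s (k + 1) ∈ M.evalFrom {s k} (segment α (p k) (p (k + 1)))) :
    ∃ r : ℕ → Q, (∀ k, r (p k) = s k) ∧ ∀ t, r (t + 1) ∈ M.step (r t) (α.get t) := by
  choose g hg₀ hg₁ hg using fun k =>
    exists_path_of_mem_evalFrom_segment M α (hp (Nat.lt_succ_self k)).le (h k)
  have hK : ∀ t, ∃ k, p k ≤ t ∧ t < p (k + 1) := by
    intro t
    induction t with
    | zero => exact ⟨0, hp₀.le, (Nat.zero_le _).trans_lt (hp (Nat.lt_succ_self 0))⟩
    | succ t ih =>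
      obtain ⟨k, h₁, h₂⟩ := ih
      rcases (Nat.succ_le_of_lt h₂).lt_or_eq with h | h
      · exact ⟨k, by omega, h⟩
      · exact ⟨k + 1, h.ge, h.trans_lt (hp (Nat.lt_succ_self _))⟩
  -- `K t` is the index of the block containing position `t`.
  choose K hK₁ hK₂ using hK
  have huniq : ∀ t k, p k ≤ t → t < p (k + 1) → K t = k := by
    intro t k h₁ h₂
    have h₃ := hp.lt_iff_lt.mp ((hK₁ t).trans_lt h₂)
    have h₄ := hp.lt_iff_lt.mp (h₁.trans_lt (hK₂ t))
    omega
  have hend : ∀ k, K (p k) = k := fun k => huniq _ _ le_rfl (hp (Nat.lt_succ_self k))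
  refine ⟨fun t => g (K t) t, fun k => ?_, fun t => ?_⟩
  · simp only [hend, hg₀]
  · have hstep := hg (K t) t (hK₁ t) (hK₂ t)
    rcases (Nat.succ_le_of_lt (hK₂ t)).lt_or_eq with h | h
    · have e : K (t + 1) = K t := huniq _ _ ((hK₁ t).trans t.le_succ) h
      simpa only [e] using hstep
    · have e : K (t + 1) = K t + 1 := by
        rw [← Nat.succ_eq_add_one, h]
        exact hend _
      have e' : g (K t + 1) (t + 1) = g (K t) (t + 1) := by
        rw [← Nat.succ_eq_add_one t, h, hg₀, hg₁]
      simp only [e, e']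
      exact hstep

end Runs

/-! ### Recognition through transitions -/

/-- Words with the same image induce the same transitions of the automaton. -/
def RefinesTransitions {A : Type u} {Q : Type v} {S : Type*} [Semigroup S] (M : NFA A Q)
    (h : FreeSemigroup A →ₙ* S) : Prop :=
  ∀ u v, h u = h v → ∀ q q', q' ∈ M.evalFrom {q} (letters u) → q' ∈ M.evalFrom {q} (letters v)

section Recognition

variable {A : Type u} {Q : Type v} {S : Type*} [Semigroup S] {M : NFA A Q}
  {h : FreeSemigroup A →ₙ* S}

theorem RefinesTransitions.recognizes (hM : RefinesTransitions M h) :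
    Recognizes h (finiteLanguage M) := by
  refine ⟨h '' finiteLanguage M, Set.Subset.antisymm (fun w hw => ?_) fun w hw => ?_⟩
  · exact Set.mem_biUnion (Set.mem_image_of_mem h hw) rfl
  · simp only [Set.mem_iUnion] at hw
    obtain ⟨_, ⟨u, hu, rfl⟩, hw⟩ := hw
    have hw : h w = h u := hw
    obtain ⟨q, hq, hu⟩ := NFA.mem_acceptsFrom.mp hu
    obtain ⟨q₀, hq₀, hu⟩ := NFA.mem_evalFrom_iff_exists.mp hu
    exact ⟨q, hq, NFA.mem_evalFrom_iff_exists.mpr ⟨q₀, hq₀, hM u w hw.symm _ _ hu⟩⟩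

theorem concat_omegaPower_subset_buchiLanguage {K L : Set (FreeSemigroup A)} {q₀ q : Q}
    (hq₀ : q₀ ∈ M.start) (hq : q ∈ M.accept) (hK : ∀ u ∈ K, q ∈ M.evalFrom {q₀} (letters u))
    (hL : ∀ v ∈ L, q ∈ M.evalFrom {q} (letters v)) :
    concat K (omegaPower L) ⊆ buchiLanguage M := by
  rintro _ ⟨u, hu, β, ⟨w, hw, hβ⟩, rfl⟩
  -- Prepending `u` to the factors gives cut points starting at 0; the glued run begins in `q₀` and
  -- is in `q` at every later cut.
  obtain ⟨p, hp, hp₀, hseg⟩ := (hβ.cons u).exists_positions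
  obtain ⟨r, hr, hstep⟩ := exists_run_of_segments M (letters u ++ₛ β) hp hp₀
    (s := fun n => Nat.casesOn n q₀ fun _ => q) fun k => by
      rw [← hseg]
      cases k with
      | zero => exact hK u hu
      | succ k => exact hL _ (hw k)
  refine ⟨r, ⟨?_, hstep⟩, q, ?_, hq⟩
  · have := hr 0
    rw [hp₀] at this
    rwa [this]
  · refine frequently_atTop.mpr fun N => ⟨p (N + 1), ?_, hr (N + 1)⟩
    exact N.le_succ.trans (hp.id_le _)

/-- The last two conclusions concern whole classes, so they place all of `[s][e]^ω` inside the
language, not only `α`. -/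
theorem exists_linkedPair_of_mem_buchiLanguage [Finite S] (hM : RefinesTransitions M h)
    {α : Stream' A} (hα : α ∈ buchiLanguage M) :
    ∃ p : S × S, IsLinkedPair p ∧ α ∈ concat (fiber h p.1) (omegaPower (fiber h p.2)) ∧
      ∃ q₀ ∈ M.start, ∃ q ∈ M.accept, (∀ u ∈ fiber h p.1, q ∈ M.evalFrom {q₀} (letters u)) ∧
        ∀ v ∈ fiber h p.2, q ∈ M.evalFrom {q} (letters v) := by
  obtain ⟨r, ⟨hr₀, hr⟩, q, hinf, hq⟩ := hα
  obtain ⟨f, hf, hfq⟩ := extraction_of_frequently_atTop hinf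
  have hw : ∀ i j, ∃ w : FreeSemigroup A, i < j → letters w = segment α i j := by
    intro i j
    rcases Nat.lt_or_ge i j with hij | hij
    · obtain ⟨w, hw⟩ := exists_letters_eq_segment α hij
      exact ⟨w, fun _ => hw⟩
    -- An arbitrary value, as `A⁺` has no empty word to represent an empty factor.
    · exact ⟨FreeSemigroup.of (α.get 0), fun h => absurd h hij.not_gt⟩
  choose w hw using hw
  have hmul : ∀ {i j k}, i < j → j < k → w i j * w j k = w i k := by
    intro i j k hij hjk
    apply letters_injective
    rw [letters_mul, hw _ _ hij, hw _ _ hjk, hw _ _ (hij.trans hjk),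
      segment_append α hij.le hjk.le]
  obtain ⟨e, g, hg, hge⟩ := exists_monochromatic fun i j => h (w (f i) (f j))
  -- The shift by one makes `p 0` positive, so that the prefix before it is a nonempty word.
  let p : ℕ → ℕ := fun k => f (g (k + 1))
  have hp : StrictMono p := fun i j hij => hf (hg (by omega))
  have hpq : ∀ k, r (p k) = q := fun k => hfq _
  have hpe : ∀ {i j}, i < j → h (w (p i) (p j)) = e := fun hij => hge _ _ (by omega)
  have hp₀ : 0 < p 0 := (Nat.zero_le _).trans_lt (hf (hg Nat.zero_lt_one))
  have hee : e * e = e := by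
    have := congrArg h (hmul (hp Nat.zero_lt_one) (hp Nat.one_lt_two))
    rwa [map_mul, hpe Nat.zero_lt_one, hpe Nat.one_lt_two, hpe Nat.zero_lt_two] at this
  -- Cutting the prefix at `p 1` instead of `p 0` makes `e` a right factor of its image, which
  -- therefore absorbs `e`.
  have hs : h (w 0 (p 1)) = h (w 0 (p 0)) * e := by
    rw [← hmul hp₀ (hp Nat.zero_lt_one), map_mul, hpe Nat.zero_lt_one]
  refine ⟨(h (w 0 (p 1)), e), ⟨by simp only [hs, mul_assoc, hee], hee⟩, ?_, r 0, hr₀, q, hq, ?_, ?_⟩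
  · refine ⟨w 0 (p 1), rfl, α.drop (p 1), ⟨fun n => w (p (n + 1)) (p (n + 2)), fun n => ?_, ?_⟩, ?_⟩
    · exact hpe (Nat.lt_succ_self _)
    · exact isInfiniteProduct_of_positions (p := fun n => p (n + 1))
        (fun i j hij => hp.monotone (by omega)) fun n => hw _ _ (hp (Nat.lt_succ_self _))
    · rw [hw _ _ (hp₀.trans (hp Nat.zero_lt_one)), segment_append_drop α (Nat.zero_le _)]
      rfl
  · intro u hu
    refine hM (w 0 (p 1)) u (Eq.symm hu) _ _ ?_
    rw [hw _ _ (hp₀.trans (hp Nat.zero_lt_one))]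
    have := mem_evalFrom_segment M α hr (Nat.zero_le (p 1))
    rwa [hpq] at this
  · intro v hv
    refine hM (w (p 0) (p 1)) v ((hpe Nat.zero_lt_one).trans (Eq.symm hv)) _ _ ?_
    rw [hw _ _ (hp Nat.zero_lt_one)]
    have := mem_evalFrom_segment M α hr (hp Nat.zero_lt_one).le
    rwa [hpq, hpq] at this

theorem RefinesTransitions.weaklyRecognizes [Finite S] (hM : RefinesTransitions M h) :
    WeaklyRecognizes h (buchiLanguage M) := by
  -- Taking every linked pair whose product lies in the language leaves only the covering of the
  -- language to prove.
  refine ⟨{p | IsLinkedPair p ∧ concat (fiber h p.1) (omegaPower (fiber h p.2)) ⊆ buchiLanguage M},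
    fun p hp => hp.1, Set.Subset.antisymm (fun α hα => ?_) (Set.iUnion₂_subset fun p hp => hp.2)⟩
  obtain ⟨p, hp, hαp, q₀, hq₀, q, hq, hu, hv⟩ := exists_linkedPair_of_mem_buchiLanguage hM hα
  exact Set.mem_biUnion (x := p) ⟨hp, concat_omegaPower_subset_buchiLanguage hq₀ hq hu hv⟩ hαp

end Recognition

/-! ### The transition semigroup -/

/-- The transition relation of a finite word, with the states of the automaton numbered by `e`. -/
def transitionRel {A : Type u} {Q : Type v} (M : NFA A Q) {n : ℕ} (e : Q ≃ Fin n)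
    (w : FreeSemigroup A) : BoolRel (Fin n) :=
  fun i j => e.symm j ∈ M.evalFrom {e.symm i} (letters w)

theorem transitionRel_apply {A : Type u} {Q : Type v} {M : NFA A Q} {n : ℕ} {e : Q ≃ Fin n}
    {w : FreeSemigroup A} {q q' : Q} :
    transitionRel M e w (e q) (e q') ↔ q' ∈ M.evalFrom {q} (letters w) := by
  simp [transitionRel]

/-- The transition morphism of an automaton, with its states numbered by `e`. -/
def transitionHom {A : Type u} {Q : Type v} (M : NFA A Q) {n : ℕ} (e : Q ≃ Fin n) :
    FreeSemigroup A →ₙ* BoolRel (Fin n) where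
  toFun := transitionRel M e
  map_mul' u v := by
    ext i j
    rw [BoolRel.mul_apply, transitionRel, letters_mul, NFA.evalFrom_append,
      NFA.mem_evalFrom_iff_exists]
    exact e.symm.surjective.exists

theorem exists_refinesTransitions {A : Type u} [Fintype A] {Q : Type v} [Fintype Q] (M : NFA A Q)
    (hn : 2 * Fintype.card A + 3 ≤ Fintype.card Q) :
    ∃ (S : Type) (_ : Semigroup S) (_ : Finite S) (h : FreeSemigroup A →ₙ* S),
      Function.Surjective h ∧ Nat.card S < 2 ^ (Fintype.card Q ^ 2) ∧ RefinesTransitions M h := by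
  -- Numbering the states puts the semigroup in `Type`, whatever the universe of `Q`.
  let e := Fintype.equivFin Q
  let h := transitionHom M e
  refine ⟨h.srange, inferInstance, inferInstance, h.srangeRestrict, h.srangeRestrict_surjective,
    ?_, fun u v huv q q' hq => ?_⟩
  · have hlt : h.srange.carrier.ncard < Nat.card (BoolRel (Fin (Fintype.card Q))) := by
      rw [← Set.ncard_univ]
      refine Set.ncard_lt_ncard (Set.ssubset_univ_iff.mpr fun hr => ?_) (Set.toFinite _)
      exact BoolRel.not_surjective_of_card_lt hn h (Set.range_eq_univ.mp hr)
    rwa [BoolRel.card_eq, Fintype.card_fin] at hlt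
  · have huv : transitionRel M e u = transitionRel M e v := congrArg Subtype.val huv
    rw [← transitionRel_apply (e := e)] at hq ⊢
    rwa [← huv]

end BuchiRecognition

theorem mainTheorem9 (m : ℕ) :
    ∃ n_m : ℕ, 1 ≤ n_m ∧
      ∀ (A : Type u) [Fintype A], Fintype.card A = m →
      ∀ (Q : Type v) [Fintype Q] (M : NFA A Q), n_m ≤ Fintype.card Q →
        (∃ (S : Type) (_ : Semigroup S) (_ : Finite S) (h : FreeSemigroup A →ₙ* S),
          Function.Surjective h ∧ Nat.card S < 2 ^ (Fintype.card Q ^ 2) ∧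
            BuchiRecognition.Recognizes h (BuchiRecognition.finiteLanguage M)) ∧
        (∃ (S : Type) (_ : Semigroup S) (_ : Finite S) (h : FreeSemigroup A →ₙ* S),
          Function.Surjective h ∧ Nat.card S < 2 ^ (Fintype.card Q ^ 2) ∧
            BuchiRecognition.WeaklyRecognizes h (BuchiRecognition.buchiLanguage M)) := by
  -- `chordedCycle n k` is prime when `2 * k + 3 ≤ n`, and it is needed for all `k ≤ m`.
  refine ⟨2 * m + 3, by omega, fun A _ hA Q _ M hn => ?_⟩
  obtain ⟨S, hS, hfin, h, hsurj, hcard, hM⟩ :=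
    BuchiRecognition.exists_refinesTransitions M (by rwa [hA])
  exact ⟨⟨S, hS, hfin, h, hsurj, hcard, hM.recognizes⟩,
    ⟨S, hS, hfin, h, hsurj, hcard, hM.weaklyRecognizes⟩⟩
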